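/- Let $N$ be a natural number and let $M_N(\mathbb{C})$ be the algebra of complex $N\times N$ matrices with the operator norm induced by the Euclidean norm on $\mathbb{C}^N$. Write $\mathbb{D}=\{z\in\mathbb{C}:|z|<1\}$. A function $\Phi:\mathbb{D}\to M_N(\mathbb{C})$ is called a rational inner function if every entry of $\Phi$ is a rational function with its poles off $\mathbb{D}$ and if, for almost every $\theta\in\mathbb{R}$, the boundary value $\lim_{r\to1^-}\Phi(re^{i\theta})$ exists and is a unitary matrix. Such a $\Phi$ extends continuously to $\overline{\mathbb{D}}$, and it is regarded as a function on $\overline{\mathbb{D}}$ through this extension. **Theorem 3.5.** Let $F:\overline{\mathbb{D}}\to M_N(\mathbb{C})$ be holomorphic in $\mathbb{D}$ and continuous on $\overline{\mathbb{D}}$, and suppose that $\|F(z)\|\le 1$ for all $z\in\mathbb{D}$. Then $F$ can be uniformly approximated on $\overline{\mathbb{D}}$ by convex combinations of $M_N(\mathbb{C})$-valued rational inner functions; that is, for every $\varepsilon>0$ there is a finite convex combination $G$ of $M_N(\mathbb{C})$-valued rational inner functions such that $\|F(z)-G(z)\|<\varepsilon$ for all $z\in\overline{\mathbb{D}}$.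 -/

import Mathlib

/- `M_N(ℂ)` carries the operator norm with respect to the Euclidean norm on `ℂ^N`. -/
open scoped Matrix.Norms.L2Operator

/-- `Φ` is rational on the open unit disc: every entry is, on the disc, a rational function
with its poles off the disc. -/
def IsRationalOnDisc {N : ℕ} (Φ : ℂ → Matrix (Fin N) (Fin N) ℂ) : Prop :=
  ∀ i j, ∃ p q : Polynomial ℂ, ∀ z ∈ Metric.ball (0 : ℂ) 1,
    q.eval z ≠ 0 ∧ Φ z i j = p.eval z / q.eval z

/-- At almost every point `e^{iθ}` of the unit circle, the boundary value
`lim_{r → 1⁻} Φ(r e^{iθ})` exists and is a unitary matrix. -/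
def HasUnitaryBoundaryValues {N : ℕ} (Φ : ℂ → Matrix (Fin N) (Fin N) ℂ) : Prop :=
  ∀ᵐ θ : ℝ, ∃ U ∈ Matrix.unitaryGroup (Fin N) ℂ,
    Filter.Tendsto (fun r : ℝ => Φ (circleMap 0 r θ)) (nhdsWithin 1 (Set.Iio 1)) (nhds U)

/-- A matrix-valued rational inner function, regarded as a function on the closed unit disc:
on the open disc it is rational and inner, and its values on the unit circle are those of its
continuous extension. (The values of `Φ` outside the closed disc play no role.) -/
structure IsRationalInner {N : ℕ} (Φ : ℂ → Matrix (Fin N) (Fin N) ℂ) : Prop where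
  rational : IsRationalOnDisc Φ
  inner : HasUnitaryBoundaryValues Φ
  continuousOn : ContinuousOn Φ (Metric.closedBall 0 1)

/-!
`F` is close to a dilation `z ↦ f (r z)` of a rational inner function `f`, and such a dilation is
close to a convex combination of rational inner functions. Two facts carry the argument.

*Dilations of inner functions are averages of inner functions.* Let `μ l = (l + r) / (1 + r l)`. For
fixed `z` in the closed disc, `l ↦ f (μ l * z)` is holomorphic with value `f (r z)` at `l = 0`, so
`f (r z)` is its average over `|l| = 1`. There `|μ l| = 1`, so each `z ↦ f (μ l * z)` is a rotation
of `f`, hence again rational inner. The average, taken in the Banach space of continuous functions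
on the closed disc, lies in the closed convex hull
(`exists_mem_convexHull_norm_dilation_sub_lt`).

*Contractive functions are locally uniform limits of rational inner functions.* After shrinking,
take `W` holomorphic across the circle with `‖W‖ ≤ ρ < 1`. Its Cayley transform
`(1 + W) (1 - W)⁻¹` has real part bounded below by a positive constant, and so does a Taylor
polynomial `H` of it on the closed disc. For large `n` let `Q` be the polynomial equal to
`z ^ n H*` on the circle. On the circle, where `z ^ n ≠ 1`, `(H + Q) / (1 - z ^ n)` is skew-adjoint, so its inverse
Cayley transform `f = (H + Q - (1 - z ^ n)) (H + Q + (1 - z ^ n))⁻¹` is unitary there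
(`cayley_mem_unitaryGroup`). Positivity of the real part of `H` and the maximum principle make the
denominator invertible on the closed disc (`isUnit_cayleyDen`). On a smaller disc `Q` and `z ^ n`
are negligible for large `n`, and `f` is close to `(H - 1) (H + 1)⁻¹`, which is close to `W`
(`exists_inner_near`).

The theorem follows by taking `W z = r F (r ^ 2 z)` with `r` close to `1`: then `F z` is close to
`W (r z)` by uniform continuity, `W (r z)` is close to `f (r z)`, and `f (r z)` is close to a convex
combination of rotations of `f`.
-/

/-! ### Dilations as averages of rotations -/

lemma one_add_mul_ne_zero {r : ℝ} (hr0 : 0 ≤ r) (hr1 : r < 1) {l : ℂ} (hl : ‖l‖ ≤ 1) :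
    1 + (r : ℂ) * l ≠ 0 := by
  intro h
  have h1 : ‖(r : ℂ) * l‖ = 1 := by
    rw [show (r : ℂ) * l = -1 by linear_combination h]; simp
  rw [norm_mul, Complex.norm_real, Real.norm_of_nonneg hr0] at h1
  nlinarith [norm_nonneg l]

lemma norm_one_add_mul_sq_sub (r : ℝ) (l : ℂ) :
    ‖1 + (r : ℂ) * l‖ ^ 2 - ‖l + r‖ ^ 2 = (1 - r ^ 2) * (1 - ‖l‖ ^ 2) := by
  simp only [← Complex.normSq_eq_norm_sq, Complex.normSq_apply]
  simp
  ring

/-- The automorphism `l ↦ (l + r) / (1 + r l)` maps the disc into itself. -/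
lemma norm_moebius_lt_one {r : ℝ} (hr0 : 0 ≤ r) (hr1 : r < 1) {l : ℂ} (hl : ‖l‖ < 1) :
    ‖(l + r) / (1 + r * l)‖ < 1 := by
  rw [norm_div, div_lt_one (norm_pos_iff.2 (one_add_mul_ne_zero hr0 hr1 hl.le))]
  have h := norm_one_add_mul_sq_sub r l
  have h2 : 0 < (1 - r ^ 2) * (1 - ‖l‖ ^ 2) := by
    apply mul_pos <;> nlinarith [norm_nonneg l]
  exact lt_of_pow_lt_pow_left₀ 2 (norm_nonneg _) (by linarith)

lemma norm_moebius_eq_one {r : ℝ} (hr0 : 0 ≤ r) (hr1 : r < 1) {l : ℂ} (hl : ‖l‖ = 1) :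
    ‖(l + r) / (1 + r * l)‖ = 1 := by
  rw [norm_div, div_eq_one_iff_eq (norm_pos_iff.2 (one_add_mul_ne_zero hr0 hr1 hl.le)).ne']
  have h := norm_one_add_mul_sq_sub r l
  rw [hl] at h
  exact (sq_eq_sq₀ (norm_nonneg _) (norm_nonneg _)).1 (by linarith)

lemma norm_moebius_le_one {r : ℝ} (hr0 : 0 ≤ r) (hr1 : r < 1) {l : ℂ} (hl : ‖l‖ ≤ 1) :
    ‖(l + r) / (1 + r * l)‖ ≤ 1 :=
  hl.lt_or_eq.elim (fun h => (norm_moebius_lt_one hr0 hr1 h).le)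
    fun h => (norm_moebius_eq_one hr0 hr1 h).le

/-- If `f` is holomorphic on the disc and continuous up to the boundary, and all its rotations
belong to `S`, then each dilation `z ↦ f (r z)` is a uniform limit of convex combinations of
members of `S`. By the mean value property it is the average over `‖l‖ = 1` of the rotations
`z ↦ f (μ l * z)`, where `μ` is the automorphism of the disc with `μ 0 = r`. -/
lemma exists_mem_convexHull_norm_dilation_sub_lt {E : Type*} [NormedAddCommGroup E]
    [NormedSpace ℂ E] [CompleteSpace E] {S : Set (ℂ → E)} {f : ℂ → E}
    (hfd : DifferentiableOn ℂ f (Metric.ball 0 1))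
    (hfc : ContinuousOn f (Metric.closedBall 0 1))
    (hS : ∀ u : ℂ, ‖u‖ = 1 → (fun z => f (u * z)) ∈ S)
    {r : ℝ} (hr0 : 0 ≤ r) (hr1 : r < 1) {ε : ℝ} (hε : 0 < ε) :
    ∃ G ∈ convexHull ℝ S, ∀ z ∈ Metric.closedBall (0 : ℂ) 1, ‖f (r * z) - G z‖ < ε := by
  let K := Metric.closedBall (0 : ℂ) 1
  have : CompactSpace K := isCompact_iff_compactSpace.1 (isCompact_closedBall _ _)
  let μ : ℂ → ℂ := fun l => (l + r) / (1 + r * l)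
  have hμK : ∀ l : ℂ, ‖l‖ ≤ 1 → ‖μ l‖ ≤ 1 := fun l hl => norm_moebius_le_one hr0 hr1 hl
  have hμ1 : ∀ l : ℂ, ‖l‖ = 1 → ‖μ l‖ = 1 := fun l hl => norm_moebius_eq_one hr0 hr1 hl
  have hμd : DifferentiableOn ℂ μ K := by
    intro l hl
    have := one_add_mul_ne_zero hr0 hr1 (mem_closedBall_zero_iff.1 hl)
    apply DifferentiableAt.differentiableWithinAt
    fun_prop (disch := exact this)
  have hcirc : ∀ θ, ‖circleMap 0 1 θ‖ = 1 := fun θ => by simp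
  -- The family of rotations, as a continuous curve in the Banach space of continuous functions.
  have hjoint : Continuous fun p : ℝ × K => f (μ (circleMap 0 1 p.1) * p.2) := by
    refine hfc.comp_continuous ?_ fun p => ?_
    · refine Continuous.mul ?_ (continuous_subtype_val.comp continuous_snd)
      exact hμd.continuousOn.comp_continuous ((continuous_circleMap 0 1).comp continuous_fst)
        fun p => mem_closedBall_zero_iff.2 (hcirc _).le
    · have h2 := mem_closedBall_zero_iff.1 p.2.2
      rw [mem_closedBall_zero_iff, norm_mul, hμ1 _ (hcirc _), one_mul]
      exact h2
  let g : C(ℝ, C(K, E)) := ContinuousMap.curry ⟨_, hjoint⟩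
  have hg : ∀ θ (z : K), g θ z = f (μ (circleMap 0 1 θ) * z) := fun _ _ => rfl
  let V : Set C(K, E) := {k | ∃ G ∈ convexHull ℝ S, ∀ z : K, k z = G z}
  have hV : Convex ℝ V := by
    rintro k ⟨G, hG, hk⟩ k' ⟨G', hG', hk'⟩ a b ha hb hab
    exact ⟨a • G + b • G', convex_convexHull ℝ S hG hG' ha hb hab, fun z => by simp [hk, hk']⟩
  have hgV : ∀ θ, g θ ∈ V := fun θ =>
    ⟨_, subset_convexHull ℝ S (hS _ (hμ1 _ (hcirc θ))), fun z => hg θ z⟩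
  have hint : MeasureTheory.IntegrableOn g (Set.Ioc 0 (2 * Real.pi)) :=
    (g.continuous.integrableOn_Icc).mono_set Set.Ioc_subset_Icc_self
  have hmem := Convex.set_average_mem_closure (μ := MeasureTheory.volume)
    (t := Set.Ioc 0 (2 * Real.pi)) hV (by simp [Real.pi_pos]) measure_Ioc_lt_top.ne
    (Filter.Eventually.of_forall hgV) hint
  obtain ⟨k, ⟨G, hG, hkG⟩, hk⟩ := Metric.mem_closure_iff.1 hmem ε hε
  refine ⟨G, hG, fun z hz => ?_⟩
  have hval : (⨍ θ in Set.Ioc 0 (2 * Real.pi), g θ) ⟨z, hz⟩ = f (r * z) := by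
    have hz' := mem_closedBall_zero_iff.1 hz
    have hd : DiffContOnCl ℂ (fun l => f (μ l * z)) (Metric.ball 0 |1|) := by
      rw [abs_one]
      have hmaps : Set.MapsTo (fun l => μ l * z) (Metric.ball 0 1) (Metric.ball 0 1) := by
        intro l hl
        have h1 : ‖μ l‖ < 1 := norm_moebius_lt_one hr0 hr1 (mem_ball_zero_iff.1 hl)
        rw [mem_ball_zero_iff, norm_mul]
        nlinarith [norm_nonneg (μ l)]
      have hmaps' : Set.MapsTo (fun l => μ l * z) K K := by
        intro l hl
        have h1 := hμK l (mem_closedBall_zero_iff.1 hl)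
        rw [mem_closedBall_zero_iff, norm_mul]
        exact mul_le_one₀ h1 (norm_nonneg _) hz'
      refine ⟨hfd.comp ((hμd.mono Metric.ball_subset_closedBall).mul_const z) hmaps, ?_⟩
      rw [closure_ball _ one_ne_zero]
      exact hfc.comp (hμd.continuousOn.mul continuousOn_const) hmaps'
    have h := hd.circleAverage
    rw [Real.circleAverage, intervalIntegral.integral_of_le (by positivity)] at h
    rw [MeasureTheory.setAverage_eq, ContinuousMap.smul_apply, ContinuousMap.integral_apply hint]
    simpa [hg, μ, Real.pi_pos.le] using h
  rw [← hval, ← hkG ⟨z, hz⟩, ← dist_eq_norm]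
  exact (ContinuousMap.dist_apply_le_dist _).trans_lt hk

section

open Polynomial

/-! ### Rational inner functions -/

/-- `f` is the evaluation of a matrix with polynomial entries. -/
def HasPolynomialEntries {N : ℕ} (f : ℂ → Matrix (Fin N) (Fin N) ℂ) : Prop :=
  ∃ P : Matrix (Fin N) (Fin N) ℂ[X], ∀ z, f z = (evalRingHom z).mapMatrix P

namespace HasPolynomialEntries

variable {N : ℕ} {f g : ℂ → Matrix (Fin N) (Fin N) ℂ}

lemma pow_smul (k : ℕ) (A : Matrix (Fin N) (Fin N) ℂ) :
    HasPolynomialEntries fun z => z ^ k • A := by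
  refine ⟨A.map (monomial k), fun z => ?_⟩
  ext i j
  simp [mul_comm]

lemma add (hf : HasPolynomialEntries f) (hg : HasPolynomialEntries g) :
    HasPolynomialEntries fun z => f z + g z := by
  obtain ⟨P, hP⟩ := hf
  obtain ⟨Q, hQ⟩ := hg
  exact ⟨P + Q, fun z => by simp only [map_add, hP, hQ]⟩

lemma sub (hf : HasPolynomialEntries f) (hg : HasPolynomialEntries g) :
    HasPolynomialEntries fun z => f z - g z := by
  obtain ⟨P, hP⟩ := hf
  obtain ⟨Q, hQ⟩ := hg
  exact ⟨P - Q, fun z => by simp only [map_sub, hP, hQ]⟩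

lemma sum {ι : Type*} (s : Finset ι) {f : ι → ℂ → Matrix (Fin N) (Fin N) ℂ}
    (hf : ∀ i ∈ s, HasPolynomialEntries (f i)) :
    HasPolynomialEntries fun z => ∑ i ∈ s, f i z := by
  choose! P hP using hf
  exact ⟨∑ i ∈ s, P i, fun z => by rw [map_sum]; exact Finset.sum_congr rfl fun i hi => hP i hi z⟩

/-- A quotient of matrix polynomials is rational, by Cramer's rule. -/
lemma isRationalOnDisc_mul_inv (hf : HasPolynomialEntries f) (hg : HasPolynomialEntries g)
    (hu : ∀ z ∈ Metric.ball (0 : ℂ) 1, IsUnit (g z)) :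
    IsRationalOnDisc fun z => f z * (g z)⁻¹ := by
  obtain ⟨P, hP⟩ := hf
  obtain ⟨Q, hQ⟩ := hg
  refine fun i j => ⟨(P * Q.adjugate) i j, Q.det, fun z hz => ?_⟩
  have hdet : Q.det.eval z = (g z).det := by
    rw [hQ, ← coe_evalRingHom, RingHom.map_det]
  have hadj : ((P * Q.adjugate) i j).eval z = (f z * (g z).adjugate) i j := by
    rw [hP, hQ, ← RingHom.map_adjugate, ← map_mul]
    rfl
  have hne : (g z).det ≠ 0 := ((Matrix.isUnit_iff_isUnit_det _).1 (hu z hz)).ne_zero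
  refine ⟨hdet ▸ hne, ?_⟩
  change (f z * (g z)⁻¹) i j = _
  rw [hadj, hdet, Matrix.inv_def, Ring.inverse_eq_inv', mul_smul_comm, Matrix.smul_apply,
    smul_eq_mul, div_eq_inv_mul]

end HasPolynomialEntries

variable {N : ℕ}

lemma isRationalInner_of_unitary {f : ℂ → Matrix (Fin N) (Fin N) ℂ}
    (hr : IsRationalOnDisc f) (hc : ContinuousOn f (Metric.closedBall 0 1))
    (hu : ∀ z : ℂ, ‖z‖ = 1 → f z ∈ Matrix.unitaryGroup (Fin N) ℂ) : IsRationalInner f := by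
  refine ⟨hr, Filter.Eventually.of_forall fun θ => ⟨_, hu (circleMap 0 1 θ) (by simp), ?_⟩, hc⟩
  have h1 : ContinuousWithinAt f (Metric.closedBall 0 1) (circleMap 0 1 θ) := hc _ (by simp)
  refine h1.tendsto.comp (tendsto_nhdsWithin_iff.2 ⟨?_, ?_⟩)
  · have : Continuous fun r : ℝ => circleMap 0 r θ := by unfold circleMap; fun_prop
    exact (this.tendsto 1).mono_left nhdsWithin_le_nhds
  · filter_upwards [Ioo_mem_nhdsLT (show (0 : ℝ) < 1 by norm_num)] with r hr
    simp [abs_of_pos hr.1, hr.2.le]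

/-- Precomposition with a rotation keeps the three properties that make a function inner. -/
lemma isRationalInner_rotation {f : ℂ → Matrix (Fin N) (Fin N) ℂ}
    (hr : IsRationalOnDisc f) (hc : ContinuousOn f (Metric.closedBall 0 1))
    (hu : ∀ z : ℂ, ‖z‖ = 1 → f z ∈ Matrix.unitaryGroup (Fin N) ℂ) {u : ℂ} (h1 : ‖u‖ = 1) :
    IsRationalInner fun z => f (u * z) := by
  refine isRationalInner_of_unitary (fun i j => ?_) ?_ fun z hz => hu _ (by simp [h1, hz])
  · obtain ⟨p, q, hpq⟩ := hr i j
    refine ⟨p.comp (C u * X), q.comp (C u * X), fun z hz => ?_⟩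
    simpa using hpq (u * z) (by simpa [h1] using hz)
  · exact hc.comp (by fun_prop) fun z hz => by simpa [h1] using hz

/-! ### Inner functions from matrix polynomials with positive real part -/

/-- The polynomial with matrix coefficients `h k` for `k < m`. -/
def matPoly (h : ℕ → Matrix (Fin N) (Fin N) ℂ) (m : ℕ) (z : ℂ) : Matrix (Fin N) (Fin N) ℂ :=
  ∑ k ∈ Finset.range m, z ^ k • h k

/-- The reflection of `matPoly h m` at degree `n`. For `m ≤ n` it is the polynomial that takes the
value `z ^ n • star (matPoly h m z)` on the unit circle. -/
def matPolyRefl (h : ℕ → Matrix (Fin N) (Fin N) ℂ) (m n : ℕ) (z : ℂ) :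
    Matrix (Fin N) (Fin N) ℂ :=
  ∑ k ∈ Finset.range m, z ^ (n - k) • star (h k)

/-- With `H` the polynomial `matPoly h m` and `Q` its reflection at degree `n`, this is the
numerator `H + Q - (1 - z ^ n)` of the Cayley transform of `(H + Q) / (1 - z ^ n)`. -/
def cayleyNum (h : ℕ → Matrix (Fin N) (Fin N) ℂ) (m n : ℕ) (z : ℂ) : Matrix (Fin N) (Fin N) ℂ :=
  matPoly h m z + matPolyRefl h m n z - (1 - z ^ n) • 1

/-- The denominator `H + Q + (1 - z ^ n)` belonging to `cayleyNum`. -/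
def cayleyDen (h : ℕ → Matrix (Fin N) (Fin N) ℂ) (m n : ℕ) (z : ℂ) : Matrix (Fin N) (Fin N) ℂ :=
  matPoly h m z + matPolyRefl h m n z + (1 - z ^ n) • 1

variable (h : ℕ → Matrix (Fin N) (Fin N) ℂ) (m n : ℕ)

lemma hasPolynomialEntries_matPoly : HasPolynomialEntries (matPoly h m) :=
  .sum _ fun _ _ => .pow_smul _ _

lemma hasPolynomialEntries_matPolyRefl : HasPolynomialEntries (matPolyRefl h m n) :=
  .sum _ fun _ _ => .pow_smul _ _

lemma hasPolynomialEntries_one_sub_pow :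
    HasPolynomialEntries fun z => (1 - z ^ n) • (1 : Matrix (Fin N) (Fin N) ℂ) := by
  simpa [sub_smul] using (HasPolynomialEntries.pow_smul 0 (1 : Matrix (Fin N) (Fin N) ℂ)).sub
    (.pow_smul n 1)

lemma hasPolynomialEntries_cayleyNum : HasPolynomialEntries (cayleyNum h m n) :=
  ((hasPolynomialEntries_matPoly h m).add (hasPolynomialEntries_matPolyRefl h m n)).sub
    (hasPolynomialEntries_one_sub_pow n)

lemma hasPolynomialEntries_cayleyDen : HasPolynomialEntries (cayleyDen h m n) :=
  ((hasPolynomialEntries_matPoly h m).add (hasPolynomialEntries_matPolyRefl h m n)).add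
    (hasPolynomialEntries_one_sub_pow n)

lemma differentiable_matPoly : Differentiable ℂ (matPoly h m) := by
  unfold matPoly; fun_prop

lemma differentiable_matPolyRefl : Differentiable ℂ (matPolyRefl h m n) := by
  unfold matPolyRefl; fun_prop

lemma differentiable_cayleyNum : Differentiable ℂ (cayleyNum h m n) := by
  have := differentiable_matPoly h m
  have := differentiable_matPolyRefl h m n
  unfold cayleyNum; fun_prop

lemma differentiable_cayleyDen : Differentiable ℂ (cayleyDen h m n) := by
  have := differentiable_matPoly h m
  have := differentiable_matPolyRefl h m n
  unfold cayleyDen; fun_prop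

variable {h m n}

lemma matPolyRefl_of_norm_eq_one (hmn : m ≤ n) {z : ℂ} (hz : ‖z‖ = 1) :
    matPolyRefl h m n z = z ^ n • star (matPoly h m z) := by
  rw [matPolyRefl, matPoly, star_sum, Finset.smul_sum]
  refine Finset.sum_congr rfl fun k hk => ?_
  have hk' : k ≤ n := (Finset.mem_range.1 hk).le.trans hmn
  have hzz : z * star z = 1 := by
    simpa [hz] using Complex.mul_conj' z
  rw [star_smul, smul_smul, star_pow]
  congr 1
  rw [← Nat.sub_add_cancel hk', pow_add, mul_assoc, ← mul_pow, hzz, one_pow, mul_one,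
    Nat.add_sub_cancel]

/-- On the circle, with `w = z ^ n` and `S = H + w H*`, the mixed terms `S* (1 - w)` and
`(1 - w̄) S` cancel, so that numerator and denominator have the same modulus. -/
lemma star_cayleyNum_mul_self (hmn : m ≤ n) {z : ℂ} (hz : ‖z‖ = 1) :
    star (cayleyNum h m n z) * cayleyNum h m n z =
      star (cayleyDen h m n z) * cayleyDen h m n z := by
  have hw : z ^ n * star (z ^ n) = 1 := by
    simpa [hz] using Complex.mul_conj' (z ^ n)
  rw [cayleyNum, cayleyDen, matPolyRefl_of_norm_eq_one hmn hz]
  generalize z ^ n = w at hw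
  generalize matPoly h m z = H
  have key : star (H + w • star H) * ((1 - w) • (1 : Matrix (Fin N) (Fin N) ℂ)) +
      star ((1 - w) • (1 : Matrix (Fin N) (Fin N) ℂ)) * (H + w • star H) = 0 := by
    have h1 : (1 - w) • (star H + star w • H) + (1 - star w) • (H + w • star H) =
        (1 - w * star w) • (H + star H) := by module
    simpa only [star_add, star_smul, star_star, star_sub, star_one, mul_smul_comm, smul_mul_assoc,
      mul_one, one_mul, hw, sub_self, zero_smul] using h1
  generalize (1 - w) • (1 : Matrix (Fin N) (Fin N) ℂ) = B at key
  generalize H + w • star H = S at key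
  have h2 : star (S + B) * (S + B) - star (S - B) * (S - B) = 2 * (star S * B + star B * S) := by
    rw [star_add, star_sub]; noncomm_ring
  rw [key, mul_zero] at h2
  exact (sub_eq_zero.1 h2).symm

lemma cayley_mem_unitaryGroup (hmn : m ≤ n) {z : ℂ} (hz : ‖z‖ = 1)
    (hu : IsUnit (cayleyDen h m n z)) :
    cayleyNum h m n z * (cayleyDen h m n z)⁻¹ ∈ Matrix.unitaryGroup (Fin N) ℂ := by
  have hdet := (Matrix.isUnit_iff_isUnit_det _).1 hu
  rw [Matrix.mem_unitaryGroup_iff', star_mul, mul_assoc, ← mul_assoc (star (cayleyNum h m n z)),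
    star_cayleyNum_mul_self hmn hz, mul_assoc, Matrix.mul_nonsing_inv _ hdet, mul_one, ← star_mul,
    Matrix.mul_nonsing_inv _ hdet, star_one]

/-- If `matPoly h m` has positive definite real part on the closed disc, the denominator is
invertible there. For `v ≠ 0`, `a = ‖v‖²`, `g = ⟪v, H v⟫` and `q = ⟪v, Q v⟫`, one has
`⟪v, D v⟫ = (g + a) + (q - a z ^ n)`; on the circle `|q - a z ^ n| = |g - a| < |g + a|`, and by the
maximum principle this strict domination persists in the disc. -/
lemma isUnit_cayleyDen (hmn : m ≤ n)
    (hpos : ∀ z : ℂ, ‖z‖ ≤ 1 → ∀ v : EuclideanSpace ℂ (Fin N), v ≠ 0 →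
      0 < (inner ℂ v (Matrix.toEuclideanCLM (𝕜 := ℂ) (matPoly h m z) v)).re)
    {z : ℂ} (hz : ‖z‖ ≤ 1) : IsUnit (cayleyDen h m n z) := by
  let T := Matrix.toEuclideanCLM (n := Fin N) (𝕜 := ℂ)
  have main : ∀ v : EuclideanSpace ℂ (Fin N), T (cayleyDen h m n z) v = 0 → v = 0 := by
    intro v hv
    by_contra hv0
    have ha : 0 < ‖v‖ ^ 2 := by positivity
    set a : ℝ := ‖v‖ ^ 2 with ha_def
    -- The quadratic form of `v` as a linear functional on matrices.
    let φ : Matrix (Fin N) (Fin N) ℂ →ₗ[ℂ] ℂ :=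
      { toFun := fun A => inner ℂ v (T A v)
        map_add' := fun A B => by simp
        map_smul' := fun c A => by simp }
    have hφ : ∀ A, φ A = inner ℂ v (T A v) := fun _ => rfl
    have hφ1 : φ 1 = a := by
      rw [hφ, map_one]; simp [ha_def]
    have hφstar : ∀ A, φ (star A) = star (φ A) := by
      intro A
      rw [hφ, hφ, map_star, ContinuousLinearMap.star_eq_adjoint,
        ContinuousLinearMap.adjoint_inner_right]
      simp
    have hφd : Differentiable ℂ φ := φ.toContinuousLinearMap.differentiable
    let num : ℂ → ℂ := fun x => φ (matPolyRefl h m n x) - a * x ^ n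
    let den : ℂ → ℂ := fun x => φ (matPoly h m x) + a
    have hden : ∀ x, ‖x‖ ≤ 1 → den x ≠ 0 := by
      intro x hx h0
      have h1 := congrArg Complex.re h0
      have h2 := hpos x hx v hv0
      simp only [den, Complex.add_re, Complex.ofReal_re, Complex.zero_re, hφ] at h1
      have h3 : (inner ℂ v (T (matPoly h m x) v)).re = (inner ℂ v
        (Matrix.toEuclideanCLM (𝕜 := ℂ) (matPoly h m x) v)).re := rfl
      linarith
    have hnumd : Differentiable ℂ num :=
      (hφd.comp (differentiable_matPolyRefl h m n)).sub (by fun_prop)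
    have hdend : Differentiable ℂ den :=
      (hφd.comp (differentiable_matPoly h m)).add_const _
    have hd : DiffContOnCl ℂ (fun x => num x / den x) (Metric.ball 0 1) := by
      apply DifferentiableOn.diffContOnCl
      rw [closure_ball _ one_ne_zero]
      exact hnumd.differentiableOn.div hdend.differentiableOn
        fun x hx => hden x (mem_closedBall_zero_iff.1 hx)
    obtain ⟨x, hx, hmax⟩ := Complex.exists_mem_frontier_isMaxOn_norm Metric.isBounded_ball
      (Metric.nonempty_ball.2 one_pos) hd
    rw [frontier_ball _ one_ne_zero, mem_sphere_zero_iff_norm] at hx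
    have hlt : ‖num x / den x‖ < 1 := by
      rw [norm_div, div_lt_one (norm_pos_iff.2 (hden x hx.le))]
      have h1 : num x = x ^ n * star (φ (matPoly h m x) - a) := by
        simp only [num, matPolyRefl_of_norm_eq_one hmn hx, map_smul, hφstar, star_sub, smul_eq_mul]
        simp
        ring
      have h2 : 0 < (φ (matPoly h m x)).re := hpos x hx.le v hv0
      rw [h1, norm_mul, norm_pow, hx, one_pow, one_mul, norm_star]
      refine lt_of_pow_lt_pow_left₀ 2 (norm_nonneg _) ?_
      simp only [den, ← Complex.normSq_eq_norm_sq, Complex.normSq_apply]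
      simp
      nlinarith
    have hz1 : ‖num z / den z‖ < 1 := by
      refine lt_of_le_of_lt (hmax ?_) hlt
      rw [closure_ball _ one_ne_zero]
      exact mem_closedBall_zero_iff.2 hz
    have h0 : φ (cayleyDen h m n z) = 0 := by rw [hφ, hv, inner_zero_right]
    have hsum : num z = - den z := by
      simp only [cayleyDen, map_add, map_smul, hφ1, smul_eq_mul] at h0
      simp only [num, den]
      linear_combination h0
    rw [hsum, neg_div, div_self (hden z hz)] at hz1
    simp at hz1
  rw [← Matrix.mulVec_injective_iff_isUnit]
  refine (injective_iff_map_eq_zero (Matrix.mulVecLin (cayleyDen h m n z))).2 fun v hv => ?_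
  have := main (WithLp.toLp 2 v) (by
    rw [Matrix.toEuclideanCLM_toLp]
    simpa using hv)
  simpa using this

end

section

variable {N : ℕ}

/-! ### Approximation of contractive holomorphic functions on smaller discs -/

lemma norm_matrix_one_le : ‖(1 : Matrix (Fin N) (Fin N) ℂ)‖ ≤ 1 := by
  rw [Matrix.cstar_norm_def, map_one]
  exact ContinuousLinearMap.norm_id_le

/-- The Cayley transform of a strict contraction has positive definite real part: for
`v = (1 - A) u`, the real part of `⟪v, (1 + A) u⟫` is `‖u‖² - ‖A u‖²`. -/
lemma le_re_inner_cayley {A : Matrix (Fin N) (Fin N) ℂ} {ρ : ℝ} (hA : ‖A‖ ≤ ρ) (hρ : ρ < 1)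
    (v : EuclideanSpace ℂ (Fin N)) :
    (1 - ρ ^ 2) / 4 * ‖v‖ ^ 2 ≤
      (inner ℂ v (Matrix.toEuclideanCLM (𝕜 := ℂ) ((1 + A) * Ring.inverse (1 - A)) v)).re := by
  have hunit : IsUnit (1 - A) := isUnit_one_sub_of_norm_lt_one (hA.trans_lt hρ)
  let T := Matrix.toEuclideanCLM (n := Fin N) (𝕜 := ℂ)
  set u := T (Ring.inverse (1 - A)) v with hu
  have hv : v = u - T A u := by
    have h1 : T ((1 - A) * Ring.inverse (1 - A)) v = v := by
      rw [Ring.mul_inverse_cancel _ hunit, map_one]; rfl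
    rw [← h1, map_mul, mul_apply_eq_comp, ← hu, map_sub, map_one]
    rfl
  have hAv : T ((1 + A) * Ring.inverse (1 - A)) v = u + T A u := by
    rw [map_mul, mul_apply_eq_comp, ← hu, map_add, map_one]
    rfl
  have hAu : ‖T A u‖ ≤ ρ * ‖u‖ :=
    ((T A).le_opNorm u).trans (mul_le_mul_of_nonneg_right hA (norm_nonneg _))
  have hρ0 : 0 ≤ ρ := (norm_nonneg A).trans hA
  have hinner : (inner ℂ (u - T A u) (u + T A u)).re = ‖u‖ ^ 2 - ‖T A u‖ ^ 2 := by
    have h3 : (inner ℂ (T A u) u : ℂ).re = (inner ℂ u (T A u) : ℂ).re := inner_re_symm (𝕜 := ℂ) _ _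
    have h4 : (inner ℂ u u : ℂ).re = ‖u‖ ^ 2 := inner_self_eq_norm_sq (𝕜 := ℂ) u
    have h5 : (inner ℂ (T A u) (T A u) : ℂ).re = ‖T A u‖ ^ 2 :=
      inner_self_eq_norm_sq (𝕜 := ℂ) (T A u)
    simp only [inner_sub_left, inner_add_right, Complex.sub_re, Complex.add_re]
    linarith
  change _ ≤ (inner ℂ v (T ((1 + A) * Ring.inverse (1 - A)) v)).re
  rw [hAv]
  have hvu : ‖v‖ ≤ 2 * ‖u‖ := by
    rw [hv]
    nlinarith [norm_sub_le u (T A u), norm_nonneg u]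
  have h6 : ‖v‖ ^ 2 ≤ 4 * ‖u‖ ^ 2 := by nlinarith [norm_nonneg v, norm_nonneg u]
  have h7 : ‖T A u‖ ^ 2 ≤ ρ ^ 2 * ‖u‖ ^ 2 := by
    rw [← mul_pow]; exact pow_le_pow_left₀ (norm_nonneg _) hAu 2
  have h8 : 0 ≤ 1 - ρ ^ 2 := by nlinarith
  have h9 : (inner ℂ v (u + T A u)).re = ‖u‖ ^ 2 - ‖T A u‖ ^ 2 := by
    rw [← hinner, ← hv]
  rw [h9]
  nlinarith [mul_le_mul_of_nonneg_left h6 h8]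

/-- A function holomorphic on a disc of radius larger than one is a uniform limit of its Taylor
polynomials on the closed unit disc. -/
lemma exists_matPoly_near {f : ℂ → Matrix (Fin N) (Fin N) ℂ} {R : ℝ} (hR : 1 < R)
    (hf : DifferentiableOn ℂ f (Metric.closedBall 0 R)) {η : ℝ} (hη : 0 < η) :
    ∃ h m, ∀ z : ℂ, ‖z‖ ≤ 1 → ‖matPoly h m z - f z‖ < η := by
  lift R to NNReal using by linarith
  obtain ⟨s, hs1, hsR⟩ := exists_between hR
  lift s to NNReal using by linarith
  have hp := hf.hasFPowerSeriesOnBall (by exact_mod_cast one_pos.trans hR)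
  have hu := hp.tendstoUniformlyOn (r' := s) (by exact_mod_cast hsR)
  obtain ⟨m, hm⟩ := (Metric.tendstoUniformlyOn_iff.1 hu η hη).exists
  refine ⟨(cauchyPowerSeries f 0 R).coeff, m, fun z hz => ?_⟩
  have h1 := hm z (mem_ball_zero_iff.2 (hz.trans_lt hs1))
  rw [zero_add, dist_comm, dist_eq_norm] at h1
  simpa [matPoly, FormalMultilinearSeries.partialSum] using h1

lemma norm_matPolyRefl_le (h : ℕ → Matrix (Fin N) (Fin N) ℂ) (m j : ℕ) {z : ℂ} {r : ℝ}
    (hz : ‖z‖ ≤ r) (hr : r ≤ 1) :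
    ‖matPolyRefl h m (m + j) z‖ ≤ r ^ j * ∑ k ∈ Finset.range m, ‖h k‖ := by
  rw [matPolyRefl, Finset.mul_sum]
  refine norm_sum_le_of_le _ fun k hk => ?_
  rw [norm_smul, norm_star, norm_pow]
  refine mul_le_mul_of_nonneg_right ?_ (norm_nonneg _)
  have hr0 : 0 ≤ r := (norm_nonneg z).trans hz
  have hk' := Finset.mem_range.1 hk
  exact (pow_le_pow_left₀ (norm_nonneg z) hz _).trans (pow_le_pow_of_le_one hr0 hr (by omega))

/-- Stability of the Cayley transform: if `H` is close to `(1 + A) (1 - A)⁻¹`, the perturbed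
inverse transform `(H - 1 + t) (H + 1 - t)⁻¹` is close to `A`. -/
lemma norm_cayley_sub_le {A H X : Matrix (Fin N) (Fin N) ℂ} {t : ℂ} {τ : ℝ} (hA : ‖A‖ < 1)
    (hX : X * (H + (1 - t) • 1) = H - (1 - t) • 1)
    (hτ : ‖H - (1 + A) * Ring.inverse (1 - A)‖ + ‖t‖ ≤ τ) (hτ' : τ ≤ 1 / 2) :
    ‖X - A‖ ≤ 4 * τ := by
  have hunit : IsUnit (1 - A) := isUnit_one_sub_of_norm_lt_one hA
  obtain ⟨e, he⟩ : ∃ e, e = H - (1 + A) * Ring.inverse (1 - A) := ⟨_, rfl⟩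
  rw [← he] at hτ
  have h0 : ((1 + A) * Ring.inverse (1 - A)) * (1 - A) = 1 + A := by
    rw [mul_assoc, Ring.inverse_mul_cancel _ hunit, mul_one]
  have hH : H * (1 - A) = 1 + A + e * (1 - A) := by rw [he, sub_mul, h0]; abel
  obtain ⟨T, hT⟩ : ∃ T : Matrix (Fin N) (Fin N) ℂ, T = t • 1 := ⟨_, rfl⟩
  have hTn : ‖T‖ ≤ ‖t‖ := by
    rw [hT, norm_smul]
    exact mul_le_of_le_one_right (norm_nonneg _) norm_matrix_one_le
  rw [sub_smul, one_smul, ← hT] at hX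
  have h2 : (2 : ℂ) • (X - A) = (e + T) * (1 - A) - (X - A) * ((e - T) * (1 - A))
      - A * ((e - T) * (1 - A)) := by
    have h3 : X * (H * (1 - A) + (1 - T) * (1 - A)) = H * (1 - A) - (1 - T) * (1 - A) := by
      rw [← add_mul, ← sub_mul, ← mul_assoc, hX]
    rw [hH] at h3
    have h4 : (X * (1 + A + e * (1 - A) + (1 - T) * (1 - A)) : Matrix (Fin N) (Fin N) ℂ) =
        2 * X + X * ((e - T) * (1 - A)) := by noncomm_ring
    have h5 : (1 + A + e * (1 - A) - (1 - T) * (1 - A) : Matrix (Fin N) (Fin N) ℂ) =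
        2 * A + (e + T) * (1 - A) := by noncomm_ring
    rw [h4, h5] at h3
    have h6 : 2 * X = 2 * A + (e + T) * (1 - A) - X * ((e - T) * (1 - A)) :=
      eq_sub_of_add_eq h3
    rw [two_smul, show X - A + (X - A) = 2 * X - 2 * A by noncomm_ring, h6]
    noncomm_ring
  have hA2 : ‖1 - A‖ ≤ 2 := by
    linarith [norm_sub_le (1 : Matrix (Fin N) (Fin N) ℂ) A, norm_matrix_one_le (N := N)]
  have hp : ‖(e + T) * (1 - A)‖ ≤ 2 * τ := by
    nlinarith [norm_mul_le (e + T) (1 - A), norm_add_le e T, norm_nonneg (e + T)]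
  have hm : ‖(e - T) * (1 - A)‖ ≤ 2 * τ := by
    nlinarith [norm_mul_le (e - T) (1 - A), norm_sub_le e T, norm_nonneg (e - T)]
  have h7 := congrArg norm h2
  rw [norm_smul, Complex.norm_ofNat] at h7
  have h8 : ‖(X - A) * ((e - T) * (1 - A))‖ ≤ ‖X - A‖ * (2 * τ) :=
    (norm_mul_le _ _).trans (mul_le_mul_of_nonneg_left hm (norm_nonneg _))
  have h9 : ‖A * ((e - T) * (1 - A))‖ ≤ 2 * τ :=
    (norm_mul_le _ _).trans ((mul_le_of_le_one_left (norm_nonneg _) hA.le).trans hm)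
  have h10 := norm_sub_le ((e + T) * (1 - A) - (X - A) * ((e - T) * (1 - A)))
    (A * ((e - T) * (1 - A)))
  have h11 := norm_sub_le ((e + T) * (1 - A)) ((X - A) * ((e - T) * (1 - A)))
  nlinarith [norm_nonneg (X - A)]

/-- A strictly contractive function that is holomorphic across the unit circle is approximated,
uniformly on every smaller disc, by rational inner functions. -/
lemma exists_inner_near {W : ℂ → Matrix (Fin N) (Fin N) ℂ} {R ρ : ℝ} (hR : 1 < R) (hρ : ρ < 1)
    (hW : DifferentiableOn ℂ W (Metric.closedBall 0 R))
    (hWρ : ∀ z ∈ Metric.closedBall (0 : ℂ) R, ‖W z‖ ≤ ρ)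
    {r : ℝ} (hr0 : 0 ≤ r) (hr1 : r < 1) {δ : ℝ} (hδ : 0 < δ) :
    ∃ f : ℂ → Matrix (Fin N) (Fin N) ℂ, IsRationalOnDisc f ∧
      DifferentiableOn ℂ f (Metric.closedBall 0 1) ∧
      (∀ z : ℂ, ‖z‖ = 1 → f z ∈ Matrix.unitaryGroup (Fin N) ℂ) ∧
      ∀ z : ℂ, ‖z‖ ≤ r → ‖f z - W z‖ ≤ δ := by
  have hunit : ∀ z ∈ Metric.closedBall (0 : ℂ) R, IsUnit (1 - W z) := fun z hz =>
    isUnit_one_sub_of_norm_lt_one ((hWρ z hz).trans_lt hρ)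
  have hρ0 : 0 ≤ ρ := (norm_nonneg _).trans (hWρ 0 (by simp; linarith))
  let H₀ : ℂ → Matrix (Fin N) (Fin N) ℂ := fun z => (1 + W z) * Ring.inverse (1 - W z)
  have hH₀ : DifferentiableOn ℂ H₀ (Metric.closedBall 0 R) := fun z hz =>
    ((hW z hz).const_add 1).mul (((hW z hz).const_sub 1).inverse (hunit z hz))
  set c : ℝ := (1 - ρ ^ 2) / 4 with hc
  have hc0 : 0 < c := by rw [hc]; nlinarith
  set τ : ℝ := min (1 / 2) (δ / 4) with hτ
  have hτ0 : 0 < τ := by positivity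
  obtain ⟨h, m, hhm⟩ := exists_matPoly_near hR hH₀ (show 0 < min c (τ / 2) by positivity)
  set S := ∑ k ∈ Finset.range m, ‖h k‖ with hS
  have hS0 : 0 ≤ S := Finset.sum_nonneg fun _ _ => norm_nonneg _
  obtain ⟨j, hj⟩ := exists_pow_lt_of_lt_one (show 0 < τ / 2 / (S + 1) by positivity) hr1
  have hj' : r ^ j * (S + 1) < τ / 2 := (lt_div_iff₀ (by positivity)).1 hj
  have hball : ∀ z : ℂ, ‖z‖ ≤ 1 → z ∈ Metric.closedBall (0 : ℂ) R := fun z hz =>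
    mem_closedBall_zero_iff.2 (hz.trans hR.le)
  have hden : ∀ z : ℂ, ‖z‖ ≤ 1 → IsUnit (cayleyDen h m (m + j) z) := by
    refine fun z hz => isUnit_cayleyDen (Nat.le_add_right m j) (fun z hz v hv => ?_) hz
    have h1 : c * ‖v‖ ^ 2 ≤ (inner ℂ v (Matrix.toEuclideanCLM (𝕜 := ℂ) (H₀ z) v)).re :=
      le_re_inner_cayley (hWρ z (hball z hz)) hρ v
    have h2 : ‖matPoly h m z - H₀ z‖ < c := (hhm z hz).trans_le (min_le_left _ _)
    have hvpos : 0 < ‖v‖ := norm_pos_iff.2 hv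
    set E := Matrix.toEuclideanCLM (n := Fin N) (𝕜 := ℂ) (matPoly h m z - H₀ z) with hE
    have h3 : (inner ℂ v (E v)).re ≥ -(‖matPoly h m z - H₀ z‖ * ‖v‖ ^ 2) := by
      have h4 : ‖E v‖ ≤ ‖matPoly h m z - H₀ z‖ * ‖v‖ := E.le_opNorm v
      have h5 := (Complex.abs_re_le_norm _).trans (norm_inner_le_norm (𝕜 := ℂ) v (E v))
      nlinarith [abs_le.1 h5, norm_nonneg v]
    have h6 : (inner ℂ v (E v)).re =
        (inner ℂ v (Matrix.toEuclideanCLM (𝕜 := ℂ) (matPoly h m z) v)).re -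
        (inner ℂ v (Matrix.toEuclideanCLM (𝕜 := ℂ) (H₀ z) v)).re := by
      rw [hE, map_sub, sub_apply, inner_sub_right, Complex.sub_re]
    have h7 : ‖matPoly h m z - H₀ z‖ * ‖v‖ ^ 2 < c * ‖v‖ ^ 2 :=
      mul_lt_mul_of_pos_right h2 (by positivity)
    linarith
  refine ⟨fun z => cayleyNum h m (m + j) z * (cayleyDen h m (m + j) z)⁻¹, ?_, ?_, ?_, ?_⟩
  · exact (hasPolynomialEntries_cayleyNum h m _).isRationalOnDisc_mul_inv
      (hasPolynomialEntries_cayleyDen h m _) fun z hz => hden z (mem_ball_zero_iff.1 hz).le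
  · simp only [Matrix.nonsing_inv_eq_ringInverse]
    exact fun z hz => ((differentiable_cayleyNum h m _ z).mul
      ((differentiable_cayleyDen h m _ z).inverse
        (hden z (mem_closedBall_zero_iff.1 hz)))).differentiableWithinAt
  · exact fun z hz => cayley_mem_unitaryGroup (Nat.le_add_right m j) hz (hden z hz.le)
  · intro z hz
    have hz1 : ‖z‖ ≤ 1 := hz.trans hr1.le
    have hdet := (Matrix.isUnit_iff_isUnit_det _).1 (hden z hz1)
    have hbound : ‖matPoly h m z + matPolyRefl h m (m + j) z - H₀ z‖ + ‖z ^ (m + j)‖ ≤ τ := by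
      have h1 : ‖matPoly h m z - H₀ z‖ < τ / 2 := (hhm z hz1).trans_le (min_le_right _ _)
      have h2 := norm_matPolyRefl_le h m j hz hr1.le
      have h3 : ‖z ^ (m + j)‖ ≤ r ^ j := by
        rw [norm_pow]
        exact (pow_le_pow_left₀ (norm_nonneg z) hz _).trans
          (pow_le_pow_of_le_one hr0 hr1.le (Nat.le_add_left j m))
      have h4 := norm_add_le (matPoly h m z - H₀ z) (matPolyRefl h m (m + j) z)
      rw [sub_add_eq_add_sub] at h4
      linarith
    have key := norm_cayley_sub_le (X := cayleyNum h m (m + j) z * (cayleyDen h m (m + j) z)⁻¹)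
      ((hWρ z (hball z hz1)).trans_lt hρ)
      (by
        change _ * cayleyDen h m (m + j) z = cayleyNum h m (m + j) z
        rw [mul_assoc, Matrix.nonsing_inv_mul _ hdet, mul_one])
      hbound (min_le_left _ _)
    linarith [min_le_right (1 / 2 : ℝ) (δ / 4)]

end

/-! ### Approximation on the closed disc -/

theorem theorem3p5 (N : ℕ) (F : ℂ → Matrix (Fin N) (Fin N) ℂ)
    (hF : DifferentiableOn ℂ F (Metric.ball 0 1))
    (hFc : ContinuousOn F (Metric.closedBall 0 1))
    (hF1 : ∀ z ∈ Metric.ball (0 : ℂ) 1, ‖F z‖ ≤ 1)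
    (ε : ℝ) (hε : 0 < ε) :
    ∃ G ∈ convexHull ℝ {Φ : ℂ → Matrix (Fin N) (Fin N) ℂ | IsRationalInner Φ},
      ∀ z ∈ Metric.closedBall (0 : ℂ) 1, ‖F z - G z‖ < ε := by
  have huc := (isCompact_closedBall (0 : ℂ) 1).uniformContinuousOn_of_continuous hFc
  obtain ⟨δ, hδ, hFδ⟩ := Metric.uniformContinuousOn_iff.1 huc (ε / 4) (by positivity)
  -- With `s` small and `r = 1 - s`, the function `r F (r ^ 3 z)` is close to `F z`.
  obtain ⟨s, hs0, hs⟩ := exists_between (show 0 < min (1 / 2) (min (δ / 4) (ε / 4)) by positivity)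
  obtain ⟨hs1, hs2, hs3⟩ : s < 1 / 2 ∧ s < δ / 4 ∧ s < ε / 4 := by simpa [lt_min_iff] using hs
  obtain ⟨r, hrs⟩ : ∃ r : ℝ, r = 1 - s := ⟨_, rfl⟩
  have hr0 : 0 < r := by linarith
  have hr1 : r < 1 := by linarith
  have hmaps : ∀ z ∈ Metric.closedBall (0 : ℂ) r⁻¹, (r : ℂ) ^ 2 * z ∈ Metric.ball (0 : ℂ) 1 := by
    intro z hz
    rw [mem_closedBall_zero_iff] at hz
    rw [mem_ball_zero_iff, norm_mul, norm_pow, Complex.norm_real, Real.norm_of_nonneg hr0.le]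
    calc r ^ 2 * ‖z‖ ≤ r ^ 2 * r⁻¹ := by gcongr
      _ = r := by field_simp
      _ < 1 := hr1
  have hFr : DifferentiableOn ℂ (fun z => F ((r : ℂ) ^ 2 * z)) (Metric.closedBall 0 r⁻¹) :=
    hF.comp (differentiableOn_id.const_mul _) hmaps
  obtain ⟨f, hfr, hfd, hfu, hfW⟩ := exists_inner_near
    (W := fun z => (r : ℂ) • F ((r : ℂ) ^ 2 * z)) ((one_lt_inv₀ hr0).2 hr1) hr1
    (hFr.const_smul (r : ℂ))
    (by
      intro z hz
      rw [norm_smul, Complex.norm_real, Real.norm_of_nonneg hr0.le]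
      exact mul_le_of_le_one_right hr0.le (hF1 _ (hmaps z hz)))
    hr0.le hr1 (show 0 < ε / 4 by positivity)
  obtain ⟨G, hG, hGf⟩ := exists_mem_convexHull_norm_dilation_sub_lt
    (S := {Φ : ℂ → Matrix (Fin N) (Fin N) ℂ | IsRationalInner Φ})
    (hfd.mono Metric.ball_subset_closedBall) hfd.continuousOn
    (fun u hu => isRationalInner_rotation hfr hfd.continuousOn hfu hu) hr0.le hr1
    (show 0 < ε / 4 by positivity)
  refine ⟨G, hG, fun z hz => ?_⟩
  have hz1 := mem_closedBall_zero_iff.1 hz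
  have hrz : ‖(r : ℂ) * z‖ ≤ r := by
    rw [norm_mul, Complex.norm_real, Real.norm_of_nonneg hr0.le]
    exact mul_le_of_le_one_right hr0.le hz1
  have hy : (r : ℂ) ^ 2 * (r * z) ∈ Metric.ball (0 : ℂ) 1 := by
    refine hmaps _ (mem_closedBall_zero_iff.2 (hrz.trans (hr1.le.trans ?_)))
    exact ((one_lt_inv₀ hr0).2 hr1).le
  set y := (r : ℂ) ^ 2 * (r * z) with hy_def
  have hzy : dist z y < δ := by
    have h1 : z - y = ((1 - r ^ 3 : ℝ) : ℂ) * z := by rw [hy_def]; push_cast; ring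
    have h2 : 0 ≤ 1 - r ^ 3 := by nlinarith [mul_pos hr0 hr0]
    rw [dist_eq_norm, h1, norm_mul, Complex.norm_real, Real.norm_of_nonneg h2]
    refine (mul_le_of_le_one_right h2 hz1).trans_lt ?_
    rw [hrs]
    nlinarith [mul_pos hs0 hs0]
  have e1 : ‖F z - F y‖ < ε / 4 := by
    rw [← dist_eq_norm]
    exact hFδ z hz y (Metric.ball_subset_closedBall hy) hzy
  have e2 : ‖F y - (r : ℂ) • F y‖ < ε / 4 := by
    rw [show F y - (r : ℂ) • F y = ((1 - r : ℝ) : ℂ) • F y by push_cast; module, norm_smul,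
      Complex.norm_real, Real.norm_of_nonneg (by linarith)]
    refine (mul_le_of_le_one_right (by linarith) (hF1 y hy)).trans_lt ?_
    linarith
  have e3 : ‖f (r * z) - (r : ℂ) • F y‖ ≤ ε / 4 := hfW _ hrz
  have e4 := hGf z hz
  calc ‖F z - G z‖ = ‖(F z - F y) + (F y - (r : ℂ) • F y) - (f (r * z) - (r : ℂ) • F y)
        + (f (r * z) - G z)‖ := by congr 1; abel
    _ ≤ ‖F z - F y‖ + ‖F y - (r : ℂ) • F y‖ + ‖f (r * z) - (r : ℂ) • F y‖
        + ‖f (r * z) - G z‖ :=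
      (norm_add_le _ _).trans (add_le_add_left ((norm_sub_le _ _).trans
        (add_le_add_left (norm_add_le _ _) _)) _)
    _ < ε := by linarith
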